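/- Let $X$ be a standard Borel space and let $E$ be a Borel equivalence relation on $X$ all of whose classes are countably infinite. Suppose that there is an $E$-invariant Borel probability measure on $X$, that is, a Borel probability measure $\mu$ with $\mu(T(B))=\mu(B)$ for every Borel set $B\subseteq X$ and every Borel automorphism $T\colon X\to X$ whose graph is contained in $E$. A Borel function $\rho\colon E\to(0,\infty)$ is a Borel cocycle if $\rho(x,z)=\rho(x,y)\rho(y,z)$ whenever $x\mathrel{E}y\mathrel{E}z$. A Borel cocycle $\rho$ is a Borel coboundary if there is a Borel function $f\colon X\to(0,\infty)$ with $\rho(x,y)=f(x)/f(y)$ for all $(x,y)\in E$. A Borel measure $\mu$ on $X$ is $\rho$-invariant if $\mu(T(B))=\int_B\rho(T(x),x)\,d\mu(x)$ for all Borel $B\subseteq X$ and all Borel automorphisms $T$ of $X$ whose graphs are contained in $E$. For a set $Y$ contained in the $E$-class of $z$, put $|Y|_z^\rho=\sum_{y\in Y}\rho(y,z)\in[0,\infty]$. A compression of $\rho$ is a function $\phi\colon X\to X$ whose graph is contained in $E$, such that $|\phi^{-1}(x)|_x^\rho\le 1$ for all $x\in X$ and such that $\{x\in X : |\phi^{-1}(x)|_x^\rho<1\}$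 meets every $E$-class. If $F\subseteq E$ is a Borel equivalence relation all of whose classes are finite, give $X/F$ its quotient Borel structure and let $E/F$ be the equivalence relation induced by $E$ on $X/F$. The quotient of $\rho$ by $F$ is the cocycle $\rho/F\colon E/F\to(0,\infty)$ given by $(\rho/F)(C,D)=|C|_z^\rho/|D|_z^\rho$ for any $z\in D$ (this does not depend on $z$); compressions of $\rho/F$ are defined as above, with $X/F$, $E/F$, $\rho/F$ in place of $X$, $E$, $\rho$. Then there is a Borel coboundary $\rho\colon E\to(0,\infty)$ such that 1. there is no Borel equivalence relation $F\subseteq E$ with finite classes for which there is an injective Borel compression $\phi\colon X/F\to X/F$ of $\rho/F$; and 2. there is no $\rho$-invariant Borel probability measure on $X$. -/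

import Mathlib

open MeasureTheory
open scoped ENNReal

noncomputable section

namespace BorelEq

universe u

/-- The graph of an equivalence relation, as a subset of the square. -/
def graph {X : Type u} (E : Setoid X) : Set (X × X) := {p | E p.1 p.2}

/-- The open interval `(0, ∞)` of real numbers. -/
abbrev PosReal : Type := {r : ℝ // 0 < r}

/-- The equivalence relation is a Borel subset of the square. -/
def IsBorel {X : Type u} [MeasurableSpace X] (E : Setoid X) : Prop :=
  MeasurableSet (graph E)

/-- All classes are countable. -/
def HasCountableClasses {X : Type u} (E : Setoid X) : Prop :=
  ∀ x : X, {y | E y x}.Countable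

/-- All classes are finite. -/
def HasFiniteClasses {X : Type u} (E : Setoid X) : Prop :=
  ∀ x : X, {y | E y x}.Finite

/-- All classes are infinite. -/
def IsAperiodic {X : Type u} (E : Setoid X) : Prop :=
  ∀ x : X, {y | E y x}.Infinite

/-- `μ` is `E`-invariant: `μ (T(B)) = μ B` for all Borel sets `B` and all Borel automorphisms `T`
of `X` whose graphs are contained in `E`. -/
def IsInvariant {X : Type u} [MeasurableSpace X] (E : Setoid X) (μ : Measure X) : Prop :=
  ∀ T : X ≃ᵐ X, (∀ x, E x (T x)) → ∀ B : Set X, MeasurableSet B → μ (T '' B) = μ B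

/-- The cocycle identity `ρ(x, z) = ρ(x, y) ρ(y, z)`, for `ρ : E → (0, ∞)`. -/
def IsCocycle {X : Type u} {E : Setoid X} (ρ : graph E → PosReal) : Prop :=
  ∀ (x y z : X) (hxy : E x y) (hyz : E y z),
    (ρ ⟨(x, z), E.trans hxy hyz⟩ : ℝ) = (ρ ⟨(x, y), hxy⟩ : ℝ) * (ρ ⟨(y, z), hyz⟩ : ℝ)

/-- A Borel cocycle `ρ : E → (0, ∞)`; here `E` has the Borel structure of a subset of the
square. -/
def IsBorelCocycle {X : Type u} [MeasurableSpace X] {E : Setoid X} (ρ : graph E → PosReal) :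
    Prop :=
  Measurable ρ ∧ IsCocycle ρ

/-- A Borel cocycle of the form `ρ(x, y) = f(x) / f(y)` for some Borel `f : X → (0, ∞)`. -/
def IsBorelCoboundary {X : Type u} [MeasurableSpace X] {E : Setoid X} (ρ : graph E → PosReal) :
    Prop :=
  IsBorelCocycle ρ ∧ ∃ f : X → PosReal, Measurable f ∧
    ∀ (x y : X) (h : E x y), (ρ ⟨(x, y), h⟩ : ℝ) = (f x : ℝ) / (f y : ℝ)

/-- `μ` is `ρ`-invariant: `μ (T(B)) = ∫_B ρ(T(x), x) dμ(x)` for all Borel sets `B` and all Borel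
automorphisms `T` of `X` whose graphs are contained in `E`. -/
def IsCocycleInvariant {X : Type u} [MeasurableSpace X] {E : Setoid X} (ρ : graph E → PosReal)
    (μ : Measure X) : Prop :=
  ∀ (T : X ≃ᵐ X) (hT : ∀ x, E x (T x)) (B : Set X), MeasurableSet B →
    μ (T '' B) = ∫⁻ x in B, ENNReal.ofReal (ρ ⟨(T x, x), E.symm (hT x)⟩ : ℝ) ∂μ

/-- The `ρ`-size of `Y` relative to the point `z`, namely `∑_{y ∈ Y} ρ(y, z)`. It is meant for
sets `Y` contained in the class of `z`; in general the points of `Y` in that class are counted. -/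
def size {X : Type u} {E : Setoid X} (ρ : graph E → PosReal) (Y : Set X) (z : X) : ℝ≥0∞ :=
  ∑' y : {y : X // y ∈ Y ∧ E y z}, ENNReal.ofReal (ρ ⟨((y : X), z), y.2.2⟩ : ℝ)

/-- `φ` is a compression of `ρ`: its graph is contained in `E`, the `ρ`-size of `φ⁻¹(x)` relative
to `x` is at most one for all `x`, and the set of `x` where it is less than one meets every
`E`-class. -/
def IsCompression {X : Type u} {E : Setoid X} (ρ : graph E → PosReal) (φ : X → X) : Prop :=
  (∀ x, E x (φ x)) ∧
  (∀ x, size ρ (φ ⁻¹' {x}) x ≤ 1) ∧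
  (∀ x, ∃ y, E x y ∧ size ρ (φ ⁻¹' {y}) y < 1)

/-- The equivalence relation `E / F` on `X / F`, for a subequivalence relation `F` of `E`. -/
def quotientRel {X : Type u} (E F : Setoid X) (hFE : F ≤ E) : Setoid (Quotient F) where
  r a b := Quotient.liftOn₂ a b (fun x y => E x y) (fun _ _ _ _ h₁ h₂ => propext
    ⟨fun h => E.trans (E.symm (hFE h₁)) (E.trans h (hFE h₂)),
     fun h => E.trans (hFE h₁) (E.trans h (E.symm (hFE h₂)))⟩)
  iseqv :=
    { refl := fun a => Quotient.inductionOn a fun x => E.refl x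
      symm := fun {a b} => Quotient.inductionOn₂ a b fun _ _ h => E.symm h
      trans := fun {a b c} => Quotient.inductionOn₃ a b c fun _ _ _ h₁ h₂ => E.trans h₁ h₂ }

/-- The subset of `X` that a point of `X / F` is. -/
def classOf {X : Type u} {F : Setoid X} (C : Quotient F) : Set X := {x | Quotient.mk F x = C}

theorem classOf_finite {X : Type u} {F : Setoid X} (hF : HasFiniteClasses F) (C : Quotient F) :
    (classOf C).Finite := by
  induction C using Quotient.inductionOn with
  | h x => exact (hF x).subset fun y hy => Quotient.exact hy

theorem rel_out {X : Type u} {E F : Setoid X} (hFE : F ≤ E) {C D : Quotient F}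
    (h : quotientRel E F hFE C D) {x z : X} (hx : x ∈ classOf C) (hz : z ∈ classOf D) :
    E x z := by
  subst hx; subst hz; exact h

theorem size_ne_zero {X : Type u} {E : Setoid X} (ρ : graph E → PosReal) {Y : Set X} {y z : X}
    (hy : y ∈ Y) (hyz : E y z) : size ρ Y z ≠ 0 := by
  intro h
  have h' := (ENNReal.tsum_eq_zero.1 h) ⟨y, hy, hyz⟩
  rw [ENNReal.ofReal_eq_zero] at h'
  exact absurd (ρ ⟨(y, z), hyz⟩).2 (not_lt.2 h')

theorem size_ne_top {X : Type u} {E : Setoid X} (ρ : graph E → PosReal) {Y : Set X}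
    (hY : Y.Finite) (z : X) : size ρ Y z ≠ ∞ := by
  have : Finite {y : X // y ∈ Y ∧ E y z} := (hY.subset fun y (hy : y ∈ Y ∧ E y z) => hy.1)
  have := Fintype.ofFinite {y : X // y ∈ Y ∧ E y z}
  unfold size
  rw [tsum_fintype]
  exact (ENNReal.sum_lt_top.2 fun _ _ => ENNReal.ofReal_lt_top).ne

/-- The `ρ`-size of `Y` relative to the set `Z`, computed from the base point `z` of `Z`. -/
def relSize {X : Type u} {E : Setoid X} (ρ : graph E → PosReal) (Y Z : Set X) (z : X) : ℝ≥0∞ :=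
  size ρ Y z / size ρ Z z

theorem size_change_base {X : Type u} {E : Setoid X} {ρ : graph E → PosReal} (hρ : IsCocycle ρ)
    (Y : Set X) {z z' : X} (h : E z z') :
    size ρ Y z' = size ρ Y z * ENNReal.ofReal (ρ ⟨(z, z'), h⟩ : ℝ) := by
  unfold size
  rw [← ENNReal.tsum_mul_right]
  let e : {y : X // y ∈ Y ∧ E y z} ≃ {y : X // y ∈ Y ∧ E y z'} :=
    Equiv.subtypeEquivRight fun y => and_congr_right fun _ =>
      ⟨fun hy => E.trans hy h, fun hy => E.trans hy (E.symm h)⟩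
  rw [← e.tsum_eq]
  refine tsum_congr fun y => ?_
  rw [← ENNReal.ofReal_mul (ρ ⟨((y : X), z), y.2.2⟩).2.le, ← hρ (y : X) z z' y.2.2 h]
  rfl

/-- For a cocycle, the relative size does not depend on the base point. -/
theorem relSize_eq {X : Type u} {E : Setoid X} {ρ : graph E → PosReal} (hρ : IsCocycle ρ)
    (Y Z : Set X) {z z' : X} (h : E z z') : relSize ρ Y Z z' = relSize ρ Y Z z := by
  unfold relSize
  rw [size_change_base hρ Y h, size_change_base hρ Z h]
  refine ENNReal.mul_div_mul_right _ _ ?_ ENNReal.ofReal_ne_top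
  exact (ENNReal.ofReal_pos.2 (ρ ⟨(z, z'), h⟩).2).ne'

/-- The quotient `ρ / F : E / F → (0, ∞)` of `ρ` by a finite subequivalence relation `F` of `E`:
its value at `(C, D)` is the `ρ`-size of the set `C` relative to the set `D`. -/
def quotientCocycle {X : Type u} {E F : Setoid X} (hFE : F ≤ E) (hF : HasFiniteClasses F)
    (ρ : graph E → PosReal) : graph (quotientRel E F hFE) → PosReal := fun p =>
  ⟨(relSize ρ (classOf p.1.1) (classOf p.1.2) p.1.2.out).toReal, by
    have hz : p.1.2.out ∈ classOf p.1.2 := Quotient.out_eq _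
    have hx : p.1.1.out ∈ classOf p.1.1 := Quotient.out_eq _
    exact ENNReal.toReal_pos
      (ENNReal.div_ne_zero.2 ⟨size_ne_zero ρ hx (rel_out hFE p.2 hx hz),
        size_ne_top ρ (classOf_finite hF _) _⟩)
      (ENNReal.div_ne_top (size_ne_top ρ (classOf_finite hF _) _)
        (size_ne_zero ρ hz (E.refl _)))⟩

/-- There is an injective Borel compression of the quotient of `ρ` by a finite Borel
subequivalence relation of `E`. Here `X / F` has the quotient Borel structure. -/
def HasInjectiveBorelQuotientCompression {X : Type u} [MeasurableSpace X] {E : Setoid X}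
    (ρ : graph E → PosReal) : Prop :=
  ∃ (F : Setoid X) (hFE : F ≤ E) (hF : HasFiniteClasses F), IsBorel F ∧
    ∃ φ : Quotient F → Quotient F, Measurable φ ∧ Function.Injective φ ∧
      IsCompression (quotientCocycle hFE hF ρ) φ

end BorelEq

end

/-! ### The Lusin–Novikov theorem -/

section LusinNovikov

open MeasureTheory Set Filter Topology

namespace BorelEq

/-! Take `ρ(x, y) = f(x) / f(y)`. The two halves of the theorem put separate demands on `f`.

The quotient by `F` of such a `ρ` is again a coboundary, given by the total `f`-weight of an
`F`-class. A compression `φ` of it never decreases the weight and strictly increases it wherever the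
defect at the image is positive. Carried over to a Borel transversal of `F`, an injective `φ`
becomes a partial injection inside `E`, which preserves the given invariant probability measure. On
a finite measure space a measure-preserving injection that does not decrease a function fixes it
almost everywhere, and its range is conull. So the defects lie in a null set; but this set meets
every class, and saturations of null sets are null. This works for every Borel `f`
(`not_hasInjectiveBorelQuotientCompression`).

If `ν` is a `ρ`-invariant probability measure, then `ν / f` is a nonzero `E`-invariant measure,
possibly infinite, for which `f` has integral 1. Hence it suffices that `f` has infinite integral
for every nonzero `E`-invariant measure (`exists_lintegral_eq_top`). Cut `X` into disjoint Borel
pieces, the `n`-th having at least the fraction `3⁻⁽ⁿ⁺¹⁾` of the mass for all invariant measures at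
once, and let `f` be `3ⁿ⁺¹` there. The pieces come from maximal matchings inside the classes
(`exists_split`).

Both halves rest on Lusin–Novikov uniformization and the resulting Feldman–Moore covering of `E` by
partial injections. -/

variable {X Y Z : Type*} [MeasurableSpace X] [MeasurableSpace Y]

/-- A countable union of Borel graphs of partial functions. -/
def IsSigmaGraph (C : Set (X × Y)) : Prop :=
  ∃ G : ℕ → Set (X × Y), (∀ n, MeasurableSet (G n)) ∧ (∀ n, InjOn Prod.fst (G n)) ∧ C = ⋃ n, G n

theorem IsSigmaGraph.measurableSet {C : Set (X × Y)} (hC : IsSigmaGraph C) : MeasurableSet C := by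
  obtain ⟨G, hG, -, rfl⟩ := hC
  exact .iUnion hG

theorem isSigmaGraph_of_injOn {C : Set (X × Y)} (hC : MeasurableSet C) (h : InjOn Prod.fst C) :
    IsSigmaGraph C :=
  ⟨fun _ => C, fun _ => hC, fun _ => h, (iUnion_const C).symm⟩

theorem IsSigmaGraph.iUnion {ι : Type*} [Countable ι] {C : ι → Set (X × Y)}
    (hC : ∀ i, IsSigmaGraph (C i)) : IsSigmaGraph (⋃ i, C i) := by
  rcases isEmpty_or_nonempty ι with hι | hι
  · rw [iUnion_of_empty]
    exact isSigmaGraph_of_injOn .empty (injOn_empty _)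
  choose G hGm hGi hG using hC
  obtain ⟨e, he⟩ := exists_surjective_nat (ι × ℕ)
  refine ⟨fun n => G (e n).1 (e n).2, fun n => hGm _ _, fun n => hGi _ _, ?_⟩
  rw [he.iUnion_comp (fun p : ι × ℕ => G p.1 p.2), iUnion_prod']
  exact iUnion_congr hG

theorem IsSigmaGraph.union {C D : Set (X × Y)} (hC : IsSigmaGraph C) (hD : IsSigmaGraph D) :
    IsSigmaGraph (C ∪ D) := by
  rw [union_eq_iUnion]
  exact .iUnion (by rintro (_ | _) <;> assumption)

theorem IsSigmaGraph.inter {C D : Set (X × Y)} (hC : IsSigmaGraph C) (hD : MeasurableSet D) :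
    IsSigmaGraph (C ∩ D) := by
  obtain ⟨G, hG, hGi, rfl⟩ := hC
  exact ⟨fun n => G n ∩ D, fun n => (hG n).inter hD,
    fun n => (hGi n).mono inter_subset_left, iUnion_inter _ _⟩

/-- Finitely many analytic sets, whose intersection does not meet a given Borel set, can be
enlarged to Borel sets with the same property. -/
theorem exists_measurableSet_iInter_eq_empty [TopologicalSpace X] [BorelSpace X]
    [PolishSpace X] {ι : Type*} (A : ι → Set X) (hA : ∀ i, AnalyticSet (A i)) (s : Finset ι) :
    ∀ B : Set X, MeasurableSet B → (B ∩ ⋂ i ∈ s, A i = ∅) →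
      ∃ A' : ι → Set X, (∀ i, MeasurableSet (A' i)) ∧ (∀ i, A i ⊆ A' i) ∧
        B ∩ ⋂ i ∈ s, A' i = ∅ := by
  classical
  induction s using Finset.induction_on with
  | empty =>
    intro B _ h
    exact ⟨fun _ => univ, fun _ => .univ, fun _ => subset_univ _, by simpa using h⟩
  | insert a s ha ih =>
    intro B hB h
    have hs : AnalyticSet (B ∩ ⋂ i ∈ s, A i) := by
      have : B ∩ ⋂ i ∈ s, A i = ⋂ o : Option s, o.elim B fun i => A i := by
        ext x
        simp [Option.forall]
      rw [this]
      refine AnalyticSet.iInter fun o => ?_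
      cases o with
      | none => exact hB.analyticSet
      | some i => exact hA i
    have hd : Disjoint (A a) (B ∩ ⋂ i ∈ s, A i) := by
      rw [disjoint_iff_inter_eq_empty, ← h, Finset.set_biInter_insert]
      ac_rfl
    obtain ⟨u, hu, hdu, hum⟩ := (hA a).measurablySeparable hs hd
    obtain ⟨A', hA'm, hA', he⟩ := ih (B ∩ u) (hB.inter hum) (by
      rw [disjoint_iff_inter_eq_empty] at hdu
      rw [← hdu]
      ac_rfl)
    refine ⟨Function.update A' a u, fun i => ?_, fun i => ?_, ?_⟩
    · rcases eq_or_ne i a with rfl | hi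
      · simpa using hum
      · simpa [hi] using hA'm i
    · rcases eq_or_ne i a with rfl | hi
      · simpa using hu
      · simpa [hi] using hA' i
    · rw [← he, Finset.set_biInter_insert, Function.update_self, inter_assoc]
      congr 2
      refine iInter₂_congr fun i hi => ?_
      rw [Function.update_of_ne (ne_of_mem_of_not_mem hi ha)]

/-- An analytic graph of a partial function is contained in a Borel one. -/
theorem exists_measurableSet_injOn_fst [TopologicalSpace X] [BorelSpace X] [PolishSpace X]
    [StandardBorelSpace Y] [MeasurableSpace Z] [StandardBorelSpace Z] {g : Z → X × Y}
    (hg : Measurable g) {D : Set Z} (hD : MeasurableSet D) (hi : InjOn Prod.fst (g '' D)) :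
    ∃ G : Set (X × Y), MeasurableSet G ∧ InjOn Prod.fst G ∧ g '' D ⊆ G := by
  obtain ⟨V, hVm, hV⟩ := exists_seq_separating Y (p := MeasurableSet) MeasurableSet.univ univ
  -- The image of `D` is the graph of a partial function; the analytic sets where its value lies in
  -- `V n` and outside `V n` are disjoint. Borel separators `W n` then code the value at each point.
  have key (n : ℕ) : MeasurablySeparable ((fun z => (g z).1) '' (D ∩ (fun z => (g z).2) ⁻¹' V n))
      ((fun z => (g z).1) '' (D \ (fun z => (g z).2) ⁻¹' V n)) := by
    have h1 := (hD.inter (hg.snd (hVm n))).analyticSet_image hg.fst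
    have h2 := (hD.diff (hg.snd (hVm n))).analyticSet_image hg.fst
    refine h1.measurablySeparable h2 (disjoint_left.2 ?_)
    rintro _ ⟨z, ⟨hz, hzV⟩, rfl⟩ ⟨w, ⟨hw, hwV⟩, hwz⟩
    have := hi (mem_image_of_mem g hw) (mem_image_of_mem g hz) hwz
    exact hwV (by simpa [this] using hzV)
  choose W hW hWd hWm using key
  refine ⟨{p | ∀ n, p.1 ∈ W n ↔ p.2 ∈ V n}, ?_, ?_, ?_⟩
  · rw [ofPred_forall]
    exact .iInter fun n => (measurable_fst (hWm n)).iff (measurable_snd (hVm n))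
  · rintro ⟨x, y⟩ h ⟨x', y'⟩ h' (rfl : x = x')
    exact Prod.ext rfl (hV y trivial y' trivial fun n => (h n).symm.trans (h' n))
  · rintro _ ⟨z, hz, rfl⟩ n
    refine ⟨fun h => ?_, fun h => hW n ⟨z, ⟨hz, h⟩, rfl⟩⟩
    by_contra hn
    exact disjoint_left.1 (hWd n) ⟨z, ⟨hz, hn⟩, rfl⟩ h

/-- For every countable union `C` of Borel partial functions, some vertical line meets the images
of all the `S i` outside of `C`. -/
def Large {ι : Type*} (g : Z → X × Y) (S : ι → Set Z) : Prop :=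
  ∀ C, IsSigmaGraph C → ∃ x, ∀ i, ∃ z ∈ S i, (g z).1 = x ∧ g z ∉ C

/-- There are only countably many candidate splittings into basic open sets. If none is large, one
σ-graph `U` absorbs the witnesses of all failures. Over any `x`, points outside `U` then cannot show
two different values in every `S i`, so the sets of `x` with two values in `S i` have empty
intersection. Enlarging these to Borel sets `W i` with empty intersection leaves, off `W i`, a
single value of `S i` outside `U`. Adding these graphs to `U` contradicts the largeness of `S`. -/
theorem Large.split {ι : Type*} [Finite ι] [TopologicalSpace X] [BorelSpace X] [PolishSpace X]
    [TopologicalSpace Y] [BorelSpace Y] [PolishSpace Y]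
    [MetricSpace Z] [SecondCountableTopology Z] [CompleteSpace Z] {g : Z → X × Y}
    (hg : Continuous g) {S : ι → Set Z} (hS : ∀ i, IsOpen (S i)) (hl : Large g S) {ε : ℝ}
    (hε : 0 < ε) :
    ∃ S' : ι × Bool → Set Z, (∀ j, IsOpen (S' j)) ∧ Large g S' ∧
      (∀ j, closure (S' j) ⊆ S j.1) ∧ (∀ j, ∀ z ∈ S' j, ∀ w ∈ S' j, dist z w ≤ ε) ∧
      ∀ i, ∀ z ∈ S' (i, false), ∀ w ∈ S' (i, true), (g z).2 ≠ (g w).2 := by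
  borelize Z
  cases nonempty_fintype ι
  let B := TopologicalSpace.countableBasis Z
  have hB : TopologicalSpace.IsTopologicalBasis B := TopologicalSpace.isBasis_countableBasis Z
  let T := {t : ι × Bool → B // (∀ j, closure (t j : Set Z) ⊆ S j.1) ∧
      (∀ j, ∀ z ∈ (t j : Set Z), ∀ w ∈ (t j : Set Z), dist z w ≤ ε) ∧
      ∀ i, ∀ z ∈ (t (i, false) : Set Z), ∀ w ∈ (t (i, true) : Set Z), (g z).2 ≠ (g w).2}
  have : Countable B := TopologicalSpace.countable_countableBasis Z
  have : Countable T := inferInstanceAs (Countable (Subtype _))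
  by_contra hcon
  have hT (t : T) : ∃ C, IsSigmaGraph C ∧
      ∀ x, ∃ i, ∀ z ∈ (t.1 i : Set Z), (g z).1 = x → g z ∈ C := by
    by_contra! h
    exact hcon ⟨fun j => t.1 j, fun j => hB.isOpen (t.1 j).2, h, t.2.1, t.2.2.1, t.2.2.2⟩
  choose C hC hCt using hT
  have hU := IsSigmaGraph.iUnion hC
  set U := ⋃ t, C t with hUdef
  -- Otherwise small neighbourhoods of the points `z j`, with separated values, form a candidate
  -- `t'`, and its witness puts some `g (z j)` into `U`.
  have hsep (z : ι × Bool → Z) (x : X) (hz : ∀ j, z j ∈ S j.1) (hx : ∀ j, (g (z j)).1 = x)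
      (hU : ∀ j, g (z j) ∉ U) : ∃ i, (g (z (i, false))).2 = (g (z (i, true))).2 := by
    by_contra! hne
    choose O O' hO hO' hzO hzO' hd using fun i => t2_separation (hne i)
    let N : ι × Bool → Set Y := fun j => if j.2 then O' j.1 else O j.1
    have hN j : IsOpen (N j) := by
      dsimp only [N]
      split_ifs
      exacts [hO' _, hO _]
    have hzN j : (g (z j)).2 ∈ N j := by
      obtain ⟨i, _ | _⟩ := j
      · simpa [N] using hzO i
      · simpa [N] using hzO' i
    have hnhds (j) : S j.1 ∩ Metric.ball (z j) (ε / 2) ∩ (fun w => (g w).2) ⁻¹' N j ∈ 𝓝 (z j) :=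
      inter_mem (inter_mem ((hS _).mem_nhds (hz j)) (Metric.ball_mem_nhds _ (half_pos hε)))
        (((hN j).preimage hg.snd).mem_nhds (hzN j))
    choose t htB hzt htc using fun j => hB.exists_closure_subset (hnhds j)
    let t' : T := ⟨fun j => ⟨t j, htB j⟩, fun j => (htc j).trans fun w hw => hw.1.1,
      fun j w hw w' hw' => by
        have h1 := (htc j (subset_closure hw)).1.2
        have h2 := (htc j (subset_closure hw')).1.2
        rw [Metric.mem_ball] at h1 h2
        linarith [dist_triangle_right w w' (z j)],
      fun i w hw w' hw' h => by
        have h1 : (g w).2 ∈ N (i, false) := (htc _ (subset_closure hw)).2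
        have h2 : (g w').2 ∈ N (i, true) := (htc _ (subset_closure hw')).2
        simp only [N, Bool.false_eq_true, if_false, if_true] at h1 h2
        exact disjoint_left.1 (hd i) h1 (h ▸ h2)⟩
    obtain ⟨j, hj⟩ := hCt t' x
    exact hU j (mem_iUnion.2 ⟨t', hj (z j) (hzt j) (hx j)⟩)
  let R : ι → Set (Z × Z) := fun i => {p | p.1 ∈ S i ∧ p.2 ∈ S i ∧ (g p.1).1 = (g p.2).1 ∧
    g p.1 ∉ U ∧ g p.2 ∉ U ∧ (g p.1).2 ≠ (g p.2).2}
  have hgm : Measurable g := hg.measurable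
  have hRm i : MeasurableSet (R i) := by
    have e1 : MeasurableSet {p : Z × Z | (g p.1).1 = (g p.2).1} :=
      measurableSet_eq_fun (hgm.fst.comp measurable_fst) (hgm.fst.comp measurable_snd)
    have e2 : MeasurableSet {p : Z × Z | (g p.1).2 = (g p.2).2} :=
      measurableSet_eq_fun (hgm.snd.comp measurable_fst) (hgm.snd.comp measurable_snd)
    exact (measurable_fst (hS i).measurableSet).inter <| (measurable_snd (hS i).measurableSet).inter
      <| e1.inter <| (hgm.comp measurable_fst hU.measurableSet).compl.inter <|
      (hgm.comp measurable_snd hU.measurableSet).compl.inter e2.compl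
  have hRa i : AnalyticSet ((fun p : Z × Z => (g p.1).1) '' R i) :=
    (hRm i).analyticSet_image (hgm.fst.comp measurable_fst)
  obtain ⟨W, hWm, hW, hWe⟩ := exists_measurableSet_iInter_eq_empty _ hRa Finset.univ univ .univ (by
    rw [univ_inter, eq_empty_iff_forall_notMem]
    intro x hx
    simp only [Finset.mem_univ, iInter_true, mem_iInter] at hx
    choose p hp hpx using hx
    obtain ⟨i, hi⟩ := hsep (fun j => if j.2 then (p j.1).2 else (p j.1).1) x
      (by rintro ⟨i, _ | _⟩ <;> simp [(hp i).1, (hp i).2.1])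
      (by rintro ⟨i, _ | _⟩ <;> simp [hpx i, (hp i).2.2.1.symm.trans (hpx i)])
      (by rintro ⟨i, _ | _⟩ <;> simp [(hp i).2.2.2.1, (hp i).2.2.2.2.1])
    exact (hp i).2.2.2.2.2 (by simpa using hi))
  have hG i := exists_measurableSet_injOn_fst hgm
    (D := S i ∩ g ⁻¹' Uᶜ ∩ (fun z => (g z).1) ⁻¹' (W i)ᶜ)
    (((hS i).measurableSet.inter (hgm hU.measurableSet.compl)).inter (hgm.fst (hWm i).compl)) (by
      rintro _ ⟨z, ⟨⟨hz, hzU⟩, hzW⟩, rfl⟩ _ ⟨w, ⟨⟨hw, hwU⟩, -⟩, rfl⟩ h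
      refine Prod.ext h ?_
      by_contra hne
      exact hzW (hW i ⟨(z, w), ⟨hz, hw, h, hzU, hwU, hne⟩, rfl⟩))
  choose G hGm hGi hG using hG
  obtain ⟨x, hx⟩ := hl (U ∪ ⋃ i, G i)
    (hU.union (.iUnion fun i => isSigmaGraph_of_injOn (hGm i) (hGi i)))
  have : ∃ i, x ∉ W i := by
    by_contra! h
    exact eq_empty_iff_forall_notMem.1 hWe x (by simpa using h)
  obtain ⟨i, hi⟩ := this
  obtain ⟨z, hz, rfl, hzU⟩ := hx i
  rw [mem_union, not_or] at hzU
  exact hzU.2 (mem_iUnion.2 ⟨i, hG i ⟨z, ⟨⟨hz, hzU.1⟩, hi⟩, rfl⟩⟩)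

theorem Large.mono_index {ι κ : Type*} {g : Z → X × Y} {S : ι → Set Z} (h : Large g S)
    (e : κ → ι) : Large g (S ∘ e) := fun C hC =>
  (h C hC).imp fun _ hx k => hx (e k)

/-- One level of a Cantor scheme of open sets, indexed by the binary words of length `n`. -/
def Level (g : Z → X × Y) [TopologicalSpace Z] (n : ℕ) : Type _ :=
  {S : (Fin n → Bool) → Set Z // (∀ i, IsOpen (S i)) ∧ Large g S}

theorem exists_next_level [TopologicalSpace X] [BorelSpace X] [PolishSpace X]
    [TopologicalSpace Y] [BorelSpace Y] [PolishSpace Y]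
    [MetricSpace Z] [SecondCountableTopology Z] [CompleteSpace Z] {g : Z → X × Y}
    (hg : Continuous g) (n : ℕ) (S : Level g n) :
    ∃ S' : Level g (n + 1), (∀ j, closure (S'.1 j) ⊆ S.1 (Fin.init j)) ∧
      (∀ j, ∀ z ∈ S'.1 j, ∀ w ∈ S'.1 j, dist z w ≤ 1 / ((n : ℝ) + 1)) ∧
      ∀ i j, Fin.init i = Fin.init j → i ≠ j → ∀ z ∈ S'.1 i, ∀ w ∈ S'.1 j, (g z).2 ≠ (g w).2 := by
  obtain ⟨S', ho, hl, hc, hd, hs⟩ := S.2.2.split hg S.2.1 (Nat.one_div_pos_of_nat (α := ℝ) (n := n))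
  refine ⟨⟨S' ∘ fun j : Fin (n + 1) → Bool => (Fin.init j, j (Fin.last n)), fun j => ho _,
    hl.mono_index _⟩, fun j => hc _, fun j => hd _, fun i j hij hne z hz w hw => ?_⟩
  have hne' : i (Fin.last n) ≠ j (Fin.last n) := fun h => hne <| by
    rw [← Fin.snoc_init_self i, ← Fin.snoc_init_self j, hij, h]
  simp only [Function.comp] at hz hw
  rw [← hij] at hw
  cases hi : i (Fin.last n) <;> cases hj : j (Fin.last n) <;> simp only [hi, hj] at hz hw hne'
  · exact absurd rfl hne'
  · exact hs _ z hz w hw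
  · exact (hs _ w hw z hz).symm
  · exact absurd rfl hne'

/-- A continuous image in `X × Y` of a Polish space is contained in a countable union of Borel
partial functions, or has an uncountable vertical section. -/
theorem exists_isSigmaGraph_of_continuous [TopologicalSpace X] [BorelSpace X] [PolishSpace X]
    [TopologicalSpace Y] [BorelSpace Y] [PolishSpace Y]
    [MetricSpace Z] [SecondCountableTopology Z] [CompleteSpace Z] {g : Z → X × Y}
    (hg : Continuous g) (hc : ∀ x, {y | (x, y) ∈ range g}.Countable) :
    ∃ C, IsSigmaGraph C ∧ range g ⊆ C := by
  by_contra! hcon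
  let S₀ : Level g 0 := ⟨fun _ => univ, fun _ => isOpen_univ, fun C hC => by
    obtain ⟨_, ⟨z, rfl⟩, hz⟩ := not_subset.1 (hcon C hC)
    exact ⟨(g z).1, fun _ => ⟨z, trivial, rfl, hz⟩⟩⟩
  choose next hcl hdist hsep using exists_next_level (X := X) (Y := Y) hg
  let S : ∀ n, Level g n := fun n => Nat.rec S₀ next n
  have hS n : S (n + 1) = next n (S n) := rfl
  let r (α : ℕ → Bool) (n : ℕ) : Fin n → Bool := fun k => α k
  have hr α n : Fin.init (r α (n + 1)) = r α n := rfl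
  -- One point `x n` serves all words of length `n`. This is what places all branches of the scheme
  -- on a single vertical line in the limit.
  choose x hx using fun n => (S n).2.2 ∅ (isSigmaGraph_of_injOn .empty (injOn_empty _))
  choose w hwS hwx _ using hx
  have hmono α : Antitone fun n => (S n).1 (r α n) := antitone_nat_of_succ_le fun n =>
    subset_closure.trans (hcl n (S n) (r α (n + 1)))
  have hcauchy α : CauchySeq fun n => w n (r α n) := by
    refine Metric.cauchySeq_iff'.2 fun ε hε => ?_
    obtain ⟨n, hn⟩ := exists_nat_one_div_lt hε
    refine ⟨n + 1, fun m hm => (hdist n (S n) (r α (n + 1)) _ ?_ _ ?_).trans_lt hn⟩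
    · exact hmono α hm (hwS m _)
    · exact hwS (n + 1) _
  choose z hz using fun α => cauchySeq_tendsto_of_complete (hcauchy α)
  have hzS α n : z α ∈ (S n).1 (r α n) := by
    refine hcl n (S n) (r α (n + 1)) (mem_closure_of_tendsto (hz α) ?_)
    filter_upwards [eventually_ge_atTop (n + 1)] with m hm
    exact hmono α hm (hwS m _)
  have hlim α : Tendsto x atTop (𝓝 (g (z α)).1) := by
    have := (hg.fst.tendsto (z α)).comp (hz α)
    exact this.congr fun n => hwx n _
  have hfst α β : (g (z α)).1 = (g (z β)).1 := tendsto_nhds_unique (hlim α) (hlim β)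
  have hinj : Function.Injective fun α => (g (z α)).2 := by
    intro α β h
    have heq n : r α n = r β n := by
      induction n with
      | zero => exact Subsingleton.elim _ _
      | succ n ih =>
        by_contra hne
        exact hsep n (S n) _ _ (by rw [hr, hr, ih]) hne _ (hzS α (n + 1)) _ (hzS β (n + 1)) h
    funext k
    exact congr_fun (heq (k + 1)) (Fin.last k)
  have hcount : (range fun α => (g (z α)).2).Countable :=
    (hc (g (z fun _ => false)).1).mono <| by
      rintro _ ⟨α, rfl⟩
      exact ⟨z α, Prod.ext (hfst _ _) rfl⟩
  have := hcount.to_subtype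
  have : Countable (ℕ → Bool) := (rangeFactorization_injective.2 hinj).countable
  obtain ⟨e, he⟩ := exists_surjective_nat (ℕ → Bool)
  obtain ⟨n, hn⟩ := he fun n => !e n n
  simpa using congr_fun hn n

/-- **Lusin–Novikov**: a Borel set with countable vertical sections is a countable union of Borel
graphs of partial functions. -/
theorem isSigmaGraph_of_countable [StandardBorelSpace X] [StandardBorelSpace Y] {P : Set (X × Y)}
    (hP : MeasurableSet P) (hc : ∀ x, {y | (x, y) ∈ P}.Countable) : IsSigmaGraph P := by
  let := upgradeStandardBorel X
  let := upgradeStandardBorel Y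
  have ha := hP.analyticSet
  rw [AnalyticSet] at ha
  rcases ha with rfl | ⟨g, hg, rfl⟩
  · exact isSigmaGraph_of_injOn .empty (injOn_empty _)
  let := TopologicalSpace.upgradeIsCompletelyMetrizable (ℕ → ℕ)
  obtain ⟨C, hC, hCg⟩ := exists_isSigmaGraph_of_continuous hg hc
  have := hC.inter hP
  rwa [inter_eq_right.2 hCg] at this

end BorelEq

end LusinNovikov

/-! ### Partial injections, invariant measures and matchings -/

noncomputable section Invariance

open MeasureTheory Set
open scoped ENNReal

namespace BorelEq

variable {X Y : Type*} [MeasurableSpace X] [MeasurableSpace Y]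

/-- `M` is a Borel graph of an injective partial function, contained in `E`. -/
structure IsPartialInjection (E : Setoid X) (M : Set (X × X)) : Prop where
  measurableSet : MeasurableSet M
  subset : M ⊆ graph E
  injOn_fst : InjOn Prod.fst M
  injOn_snd : InjOn Prod.snd M

theorem IsPartialInjection.mono {E : Setoid X} {M N : Set (X × X)}
    (hM : IsPartialInjection E M) (hN : MeasurableSet N) (h : N ⊆ M) :
    IsPartialInjection E N :=
  ⟨hN, h.trans hM.subset, hM.injOn_fst.mono h, hM.injOn_snd.mono h⟩

variable [StandardBorelSpace X] [StandardBorelSpace Y]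

theorem measurableSet_image_fst {P : Set (X × Y)} (hP : MeasurableSet P)
    (hc : ∀ x, {y | (x, y) ∈ P}.Countable) : MeasurableSet (Prod.fst '' P) := by
  obtain ⟨G, hG, hGi, rfl⟩ := isSigmaGraph_of_countable hP hc
  rw [image_iUnion]
  exact .iUnion fun n => (hG n).image_of_measurable_injOn measurable_fst (hGi n)

/-- A Borel set with countable vertical sections has a Borel uniformization. -/
theorem exists_uniformization {P : Set (X × Y)} (hP : MeasurableSet P)
    (hc : ∀ x, {y | (x, y) ∈ P}.Countable) :
    ∃ U ⊆ P, MeasurableSet U ∧ InjOn Prod.fst U ∧ Prod.fst '' U = Prod.fst '' P := by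
  classical
  obtain ⟨G, hG, hGi, rfl⟩ := isSigmaGraph_of_countable hP hc
  have hGf n : MeasurableSet (Prod.fst '' G n) :=
    (hG n).image_of_measurable_injOn measurable_fst (hGi n)
  -- At each point, use the first of the graphs that is defined there.
  refine ⟨⋃ n, G n ∩ Prod.fst ⁻¹' disjointed (fun n => Prod.fst '' G n) n,
    iUnion_mono fun n => inter_subset_left,
    .iUnion fun n => (hG n).inter (measurable_fst (.disjointed hGf n)), ?_, ?_⟩
  · intro p hp q hq hpq
    obtain ⟨m, hpm, hpm'⟩ := mem_iUnion.1 hp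
    obtain ⟨n, hqn, hqn'⟩ := mem_iUnion.1 hq
    obtain rfl : m = n := by
      by_contra hmn
      rw [mem_preimage, hpq] at hpm'
      exact disjoint_left.1 (disjoint_disjointed _ hmn) hpm' hqn'
    exact hGi m hpm hqn hpq
  · simp_rw [image_iUnion, image_inter_preimage]
    rw [← iUnion_disjointed (f := fun n => Prod.fst '' G n)]
    exact iUnion_congr fun n => inter_eq_right.2 (disjointed_subset _ n)

theorem measurable_of_measurableSet_graph {h : X → Y}
    (hh : MeasurableSet {p : X × Y | h p.1 = p.2}) : Measurable h := by
  intro B hB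
  have : h ⁻¹' B = Prod.fst '' ({p : X × Y | h p.1 = p.2} ∩ Prod.snd ⁻¹' B) := by
    ext x
    simp
  rw [this]
  refine (hh.inter (measurable_snd hB)).image_of_measurable_injOn measurable_fst ?_
  rintro ⟨x, y⟩ ⟨h1 : h x = y, -⟩ ⟨x', y'⟩ ⟨h2 : h x' = y', -⟩ (rfl : x = x')
  rw [← h1, ← h2]

variable (X) in
-- Closing a separating sequence under complements makes the separation directed, so that the sets
-- `V n ×ˢ (V n)ᶜ` cover the complement of the diagonal.
theorem exists_seq_separating_pairs :
    ∃ V : ℕ → Set X, (∀ n, MeasurableSet (V n)) ∧ ∀ x y, x ≠ y → ∃ n, x ∈ V n ∧ y ∉ V n := by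
  obtain ⟨V, hVm, hV⟩ := exists_seq_separating X (p := MeasurableSet) MeasurableSet.univ univ
  obtain ⟨e, he⟩ := exists_surjective_nat (ℕ × Bool)
  refine ⟨fun n => if (e n).2 then V (e n).1 else (V (e n).1)ᶜ, fun n => ?_, fun x y hxy => ?_⟩
  · dsimp only
    split_ifs
    exacts [hVm _, (hVm _).compl]
  · have : ∃ n, ¬ (x ∈ V n ↔ y ∈ V n) := by
      by_contra! h
      exact hxy (hV x trivial y trivial h)
    obtain ⟨n, hn⟩ := this
    by_cases hx : x ∈ V n
    · obtain ⟨k, hk⟩ := he (n, true)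
      exact ⟨k, by simp [hk]; tauto⟩
    · obtain ⟨k, hk⟩ := he (n, false)
      exact ⟨k, by simp [hk]; tauto⟩

namespace IsPartialInjection

variable {E : Setoid X} {M : Set (X × X)}

theorem measurableSet_fst (hM : IsPartialInjection E M) : MeasurableSet (Prod.fst '' M) :=
  hM.measurableSet.image_of_measurable_injOn measurable_fst hM.injOn_fst

theorem measurableSet_snd (hM : IsPartialInjection E M) : MeasurableSet (Prod.snd '' M) :=
  hM.measurableSet.image_of_measurable_injOn measurable_snd hM.injOn_snd

/-- A partial injection with disjoint domain and range extends to a Borel involution. -/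
theorem exists_involution (hM : IsPartialInjection E M)
    (hd : Disjoint (Prod.fst '' M) (Prod.snd '' M)) :
    ∃ T : X ≃ᵐ X, (∀ x, E x (T x)) ∧ T '' (Prod.fst '' M) = Prod.snd '' M := by
  -- The graph of the involution: exchange the two ends of each pair of `M` and fix all other
  -- points.
  let K : Set (X × X) := M ∪ Prod.swap ⁻¹' M ∪
    ({p | p.1 = p.2} ∩ Prod.fst ⁻¹' (Prod.fst '' M ∪ Prod.snd '' M)ᶜ)
  have hK : MeasurableSet K := by
    refine (hM.measurableSet.union (measurable_swap hM.measurableSet)).union ?_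
    exact (measurableSet_eq_fun measurable_fst measurable_snd).inter
      (measurable_fst (hM.measurableSet_fst.union hM.measurableSet_snd).compl)
  have hfs {x y z : X} (h1 : (x, y) ∈ M) (h2 : (z, x) ∈ M) : False :=
    disjoint_left.1 hd ⟨_, h1, rfl⟩ ⟨_, h2, rfl⟩
  have hex x : ∃ y, (x, y) ∈ K := by
    by_cases h1 : x ∈ Prod.fst '' M
    · obtain ⟨⟨x, y⟩, h, rfl⟩ := h1
      exact ⟨y, .inl (.inl h)⟩
    by_cases h2 : x ∈ Prod.snd '' M
    · obtain ⟨⟨y, x⟩, h, rfl⟩ := h2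
      exact ⟨y, .inl (.inr h)⟩
    exact ⟨x, .inr ⟨rfl, by simpa using ⟨by simpa using h1, by simpa using h2⟩⟩⟩
  have hun {x y z : X} (h1 : (x, y) ∈ K) (h2 : (x, z) ∈ K) : y = z := by
    rcases h1 with (h1 | h1) | ⟨h1, h1'⟩ <;> rcases h2 with (h2 | h2) | ⟨h2, h2'⟩
    · exact congr_arg Prod.snd (hM.injOn_fst h1 h2 rfl)
    · exact (hfs h1 h2).elim
    · exact absurd (.inl ⟨_, h1, rfl⟩) h2'
    · exact (hfs h2 h1).elim
    · exact congr_arg Prod.fst (hM.injOn_snd h1 h2 rfl)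
    · exact absurd (.inr ⟨_, h1, rfl⟩) h2'
    · exact absurd (.inl ⟨_, h2, rfl⟩) h1'
    · exact absurd (.inr ⟨_, h2, rfl⟩) h1'
    · exact h1.symm.trans h2
  have hsymm {x y : X} (h : (x, y) ∈ K) : (y, x) ∈ K := by
    rcases h with (h | h) | ⟨h, h'⟩
    · exact .inl (.inr h)
    · exact .inl (.inl h)
    · obtain rfl : x = y := h
      exact .inr ⟨rfl, h'⟩
  choose T hT using hex
  have hinv : Function.Involutive T := fun x => hun (hT (T x)) (hsymm (hT x))
  have hTm : Measurable T := by
    refine measurable_of_measurableSet_graph ?_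
    convert! hK
    ext ⟨x, y⟩
    exact ⟨fun h => by simpa [← show T x = y from h] using hT x, fun h => hun (hT x) h⟩
  refine ⟨⟨hinv.toPerm, hTm, hTm⟩, fun x => ?_, ?_⟩
  · change E x (T x)
    rcases hT x with (h | h) | ⟨h, -⟩
    · exact hM.subset h
    · exact E.symm (hM.subset h)
    · rw [← show x = T x from h]
  · change T '' _ = _
    rw [image_image]
    exact image_congr fun p hp => hun (hT p.1) (.inl (.inl hp))

/-- Invariance speaks only of total automorphisms. Cut `M` into its diagonal part, where both
projections agree, and countably many parts with disjoint domain and range, each of which extends to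
an involution. -/
theorem measure_image_fst_eq_image_snd (hM : IsPartialInjection E M) {μ : Measure X}
    (hμ : IsInvariant E μ) : μ (Prod.fst '' M) = μ (Prod.snd '' M) := by
  obtain ⟨V, hVm, hV⟩ := exists_seq_separating_pairs X
  let J : ℕ → Set (X × X) := fun n => n.casesOn {p | p.1 = p.2} fun n => V n ×ˢ (V n)ᶜ
  have hJm n : MeasurableSet (J n) := by
    cases n with
    | zero => exact measurableSet_eq_fun measurable_fst measurable_snd
    | succ n => exact (hVm n).prod (hVm n).compl
  have hJ : ⋃ n, J n = univ := by
    refine eq_univ_of_forall fun ⟨x, y⟩ => mem_iUnion.2 ?_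
    rcases eq_or_ne x y with rfl | hxy
    · exact ⟨0, rfl⟩
    · obtain ⟨n, hn⟩ := hV x y hxy
      exact ⟨n + 1, hn⟩
  let L : ℕ → Set (X × X) := fun n => M ∩ disjointed J n
  have hL n : IsPartialInjection E (L n) :=
    hM.mono (hM.measurableSet.inter (.disjointed hJm n)) inter_subset_left
  have hML : M = ⋃ n, L n := by
    rw [← inter_iUnion, iUnion_disjointed, hJ, inter_univ]
  have hdisj {f : X × X → X} (hf : InjOn f M) :
      Pairwise (Function.onFun Disjoint fun n => f '' L n) := by
    intro m n hmn
    refine disjoint_left.2 ?_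
    rintro _ ⟨p, hp, rfl⟩ ⟨q, hq, hpq⟩
    obtain rfl := hf hq.1 hp.1 hpq
    exact disjoint_left.1 (disjoint_disjointed J hmn) hp.2 hq.2
  rw [hML, image_iUnion, image_iUnion,
    measure_iUnion (hdisj hM.injOn_fst) fun n => (hL n).measurableSet_fst,
    measure_iUnion (hdisj hM.injOn_snd) fun n => (hL n).measurableSet_snd]
  refine tsum_congr fun n => ?_
  cases n with
  | zero =>
    congr 1
    refine image_congr fun p hp => ?_
    exact disjointed_subset J 0 hp.2
  | succ n =>
    obtain ⟨T, hT, hTM⟩ := (hL (n + 1)).exists_involution (by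
      refine disjoint_left.2 ?_
      rintro _ ⟨p, hp, rfl⟩ ⟨q, hq, hpq⟩
      exact (disjointed_subset J (n + 1) hq.2).2 (hpq ▸ (disjointed_subset J (n + 1) hp.2).1))
    rw [← hTM, hμ T hT _ (hL _).measurableSet_fst]

end IsPartialInjection

/-- **Feldman–Moore**: off the diagonal, a countable Borel equivalence relation is covered by
countably many partial injections with disjoint domain and range. -/
theorem exists_seq_isPartialInjection {E : Setoid X} (hE : IsBorel E)
    (hc : HasCountableClasses E) :
    ∃ G : ℕ → Set (X × X), (∀ n, IsPartialInjection E (G n)) ∧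
      (∀ n, Disjoint (Prod.fst '' G n) (Prod.snd '' G n)) ∧
      ∀ x y, E x y → x ≠ y → ∃ n, (x, y) ∈ G n := by
  obtain ⟨G, hG, hGi, hGE⟩ := isSigmaGraph_of_countable (P := graph E) hE fun x =>
    (hc x).mono fun y hy => E.symm hy
  obtain ⟨V, hVm, hV⟩ := exists_seq_separating_pairs X
  obtain ⟨e, he⟩ := exists_surjective_nat (ℕ × ℕ × ℕ)
  -- Intersecting a graph with a transposed graph gives injectivity in both coordinates; the
  -- rectangle separates domain from range.
  refine ⟨fun k => G (e k).1 ∩ Prod.swap ⁻¹' G (e k).2.1 ∩ V (e k).2.2 ×ˢ (V (e k).2.2)ᶜ,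
    fun k => ⟨?_, ?_, ?_, ?_⟩, fun k => ?_, fun x y h hxy => ?_⟩
  · exact ((hG _).inter (measurable_swap (hG _))).inter ((hVm _).prod (hVm _).compl)
  · rw [hGE]
    exact fun p hp => mem_iUnion.2 ⟨_, hp.1.1⟩
  · exact (hGi _).mono fun p hp => hp.1.1
  · exact fun p hp q hq hpq => Prod.swap_injective (hGi _ hp.1.2 hq.1.2 hpq)
  · refine disjoint_left.2 ?_
    rintro _ ⟨p, hp, rfl⟩ ⟨q, hq, hpq⟩
    exact hq.2.2 (hpq ▸ hp.2.1)
  · have h1 : (x, y) ∈ ⋃ n, G n := hGE ▸ h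
    have h2 : (y, x) ∈ ⋃ n, G n := hGE ▸ E.symm h
    obtain ⟨m, hm⟩ := mem_iUnion.1 h1
    obtain ⟨n, hn⟩ := mem_iUnion.1 h2
    obtain ⟨l, hl⟩ := hV x y hxy
    obtain ⟨k, hk⟩ := he (m, n, l)
    exact ⟨k, by simp only [hk]; exact ⟨⟨hm, hn⟩, hl⟩⟩

/-- The saturation of a null set is null. -/
theorem measure_saturation_eq_zero {E : Setoid X} (hE : IsBorel E) (hc : HasCountableClasses E)
    {μ : Measure X} (hμ : IsInvariant E μ) {N : Set X} (hN : MeasurableSet N) (h0 : μ N = 0) :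
    μ {x | ∃ y ∈ N, E x y} = 0 := by
  obtain ⟨G, hG, -, hGE⟩ := exists_seq_isPartialInjection hE hc
  have hsub : {x | ∃ y ∈ N, E x y} ⊆ N ∪ ⋃ n, Prod.fst '' (G n ∩ Prod.snd ⁻¹' N) := by
    rintro x ⟨y, hy, hxy⟩
    rcases eq_or_ne x y with rfl | hne
    · exact .inl hy
    · obtain ⟨n, hn⟩ := hGE x y hxy hne
      exact .inr (mem_iUnion.2 ⟨n, _, ⟨hn, hy⟩, rfl⟩)
  refine measure_mono_null hsub (measure_union_null h0 (measure_iUnion_null fun n => ?_))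
  rw [((hG n).mono ((hG n).measurableSet.inter (measurable_snd hN))
    inter_subset_left).measure_image_fst_eq_image_snd hμ]
  exact measure_mono_null (by rintro _ ⟨p, hp, rfl⟩; exact hp.2) h0

/-- Every Borel set admits a Borel matching of its points within the classes, which leaves out at
most one point of each class. -/
theorem exists_matching {E : Setoid X} (hE : IsBorel E) (hc : HasCountableClasses E) {A : Set X}
    (hA : MeasurableSet A) :
    ∃ M ⊆ A ×ˢ A, IsPartialInjection E M ∧ Disjoint (Prod.fst '' M) (Prod.snd '' M) ∧
      ∀ x ∈ A \ (Prod.fst '' M ∪ Prod.snd '' M), ∀ y ∈ A \ (Prod.fst '' M ∪ Prod.snd '' M),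
        E x y → x = y := by
  obtain ⟨G, hG, hGd, hGE⟩ := exists_seq_isPartialInjection hE hc
  let L : ℕ → Set X → Set (X × X) := fun n U => G n ∩ (A \ U) ×ˢ (A \ U)
  -- Greedy matching: `U n` consists of the points used before stage `n`, which adds all pairs of `G
  -- n` with both ends still free in `A`.
  let U : ℕ → Set X := fun n => Nat.rec ∅ (fun n U => U ∪ (Prod.fst '' L n U ∪ Prod.snd '' L n U)) n
  have hU n : U (n + 1) = U n ∪ (Prod.fst '' L n (U n) ∪ Prod.snd '' L n (U n)) := rfl
  have hLp n (hUn : MeasurableSet (U n)) : IsPartialInjection E (L n (U n)) :=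
    (hG n).mono ((hG n).measurableSet.inter ((hA.diff hUn).prod (hA.diff hUn))) inter_subset_left
  have hUm n : MeasurableSet (U n) := by
    induction n with
    | zero => exact .empty
    | succ n ih =>
      rw [hU]
      exact ih.union ((hLp n ih).measurableSet_fst.union (hLp n ih).measurableSet_snd)
  replace hLp n := hLp n (hUm n)
  have hUmono : Monotone U := monotone_nat_of_le_succ fun n => by
    rw [hU]
    exact subset_union_left
  let M : ℕ → Set (X × X) := fun n => L n (U n)
  have hfst {n p} (hp : p ∈ M n) : p.1 ∈ U (n + 1) \ U n :=
    ⟨.inr (.inl ⟨p, hp, rfl⟩), hp.2.1.2⟩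
  have hsnd {n p} (hp : p ∈ M n) : p.2 ∈ U (n + 1) \ U n :=
    ⟨.inr (.inr ⟨p, hp, rfl⟩), hp.2.2.2⟩
  have huniq {m n x} (hm : x ∈ U (m + 1) \ U m) (hn : x ∈ U (n + 1) \ U n) : m = n := by
    rcases lt_trichotomy m n with h | h | h
    · exact absurd (hUmono h hm.1) hn.2
    · exact h
    · exact absurd (hUmono h hn.1) hm.2
  refine ⟨⋃ n, M n, iUnion_subset fun n p hp => ⟨hp.2.1.1, hp.2.2.1⟩, ⟨.iUnion fun n =>
    (hLp n).measurableSet, iUnion_subset fun n => (hLp n).subset, ?_, ?_⟩, ?_, ?_⟩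
  · intro p hp q hq hpq
    obtain ⟨m, hm⟩ := mem_iUnion.1 hp
    obtain ⟨n, hn⟩ := mem_iUnion.1 hq
    obtain rfl := huniq (hfst hm) (hpq ▸ hfst hn)
    exact (hLp m).injOn_fst hm hn hpq
  · intro p hp q hq hpq
    obtain ⟨m, hm⟩ := mem_iUnion.1 hp
    obtain ⟨n, hn⟩ := mem_iUnion.1 hq
    obtain rfl := huniq (hsnd hm) (hpq ▸ hsnd hn)
    exact (hLp m).injOn_snd hm hn hpq
  · refine disjoint_left.2 ?_
    rintro _ ⟨p, hp, rfl⟩ ⟨q, hq, hpq⟩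
    obtain ⟨m, hm⟩ := mem_iUnion.1 hp
    obtain ⟨n, hn⟩ := mem_iUnion.1 hq
    obtain rfl := huniq (hfst hm) (hpq ▸ hsnd hn)
    exact disjoint_left.1 (hGd m) ⟨p, hm.1, rfl⟩ ⟨q, hn.1, hpq⟩
  · intro x hx y hy hxy
    by_contra hne
    obtain ⟨n, hn⟩ := hGE x y hxy hne
    have hout {z} (hz : z ∈ A \ (Prod.fst '' (⋃ n, M n) ∪ Prod.snd '' (⋃ n, M n))) (n : ℕ) :
        z ∉ U n := by
      induction n with
      | zero => exact notMem_empty z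
      | succ n ih =>
        rw [hU]
        rintro (h | ⟨p, hp, rfl⟩ | ⟨p, hp, rfl⟩)
        · exact ih h
        · exact hz.2 (.inl ⟨p, mem_iUnion.2 ⟨n, hp⟩, rfl⟩)
        · exact hz.2 (.inr ⟨p, mem_iUnion.2 ⟨n, hp⟩, rfl⟩)
    exact hx.2 (.inl ⟨(x, y), mem_iUnion.2 ⟨n, hn, ⟨hx.1, hout hx n⟩, ⟨hy.1, hout hy n⟩⟩, rfl⟩)

/-- A Borel set meeting every class in an infinite set splits into two Borel parts, the first of
which meets every class in an infinite set, and both of which have at least a third of its measure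
for every invariant measure. -/
theorem exists_split {E : Setoid X} (hE : IsBorel E) (hc : HasCountableClasses E) {A : Set X}
    (hA : MeasurableSet A) (hinf : ∀ x, (A ∩ {y | E y x}).Infinite) :
    ∃ A' ⊆ A, MeasurableSet A' ∧ (∀ x, (A' ∩ {y | E y x}).Infinite) ∧
      ∀ μ : Measure X, IsInvariant E μ → μ A ≤ 3 * μ A' ∧ μ A ≤ 3 * μ (A \ A') := by
  obtain ⟨M, hMA, hM, hd, hW⟩ := exists_matching hE hc hA
  set D := Prod.fst '' M with hD
  set R := Prod.snd '' M with hR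
  have hDA : D ⊆ A := by
    rintro _ ⟨p, hp, rfl⟩
    exact (hMA hp).1
  have hRA : R ⊆ A := by
    rintro _ ⟨p, hp, rfl⟩
    exact (hMA hp).2
  have hDm : MeasurableSet D := hM.measurableSet_fst
  have hRm : MeasurableSet R := hM.measurableSet_snd
  have hWm : MeasurableSet (A \ (D ∪ R)) := hA.diff (hDm.union hRm)
  have hA' : A \ (A \ R) = R := sdiff_sdiff_cancel_left hRA
  have hRx x (hx : x ∈ A \ (D ∪ R)) : ∃ y ∈ R, E x y := by
    by_contra! h
    refine hinf x ((finite_singleton x).subset ?_)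
    rintro y ⟨hyA, hyx⟩
    refine (hW x hx y ⟨hyA, ?_⟩ (E.symm hyx)).symm
    rintro (⟨p, hp, rfl⟩ | hy)
    · exact h p.2 ⟨p, hp, rfl⟩ (E.trans (E.symm hyx) (hM.subset hp))
    · exact h y hy (E.symm hyx)
  -- Each class has at most one leftover point, so any choice of a partner in `R` is injective, and
  -- the leftover set has at most the measure of `R`.
  obtain ⟨H, hHs, hHm, hHi, hHf⟩ := exists_uniformization
    (P := graph E ∩ (A \ (D ∪ R)) ×ˢ R) (MeasurableSet.inter hE (hWm.prod hRm))
    (fun x => (hc x).mono fun y hy => E.symm hy.1)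
  have hH : IsPartialInjection E H := ⟨hHm, fun p hp => (hHs hp).1, hHi, fun p hp q hq hpq => by
    refine Prod.ext (hW _ (hHs hp).2.1 _ (hHs hq).2.1 ?_) hpq
    exact E.trans (hHs hp).1 (hpq ▸ E.symm (hHs hq).1)⟩
  -- The leftover points stay with the domain `D`. Since `μ D = μ R` bounds the leftover measure,
  -- both parts get a third of `μ A`; no measure is subtracted, so `μ` may be infinite.
  refine ⟨A \ R, sdiff_subset, hA.diff hRm, fun x hfin => hinf x ?_, fun μ hμ => ?_⟩
  · have hRfin : (R ∩ {y | E y x}).Finite := by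
      have : (M ∩ Prod.fst ⁻¹' (A \ R ∩ {y | E y x})).Finite :=
        Finite.of_finite_image (hfin.subset (by rintro _ ⟨p, hp, rfl⟩; exact hp.2))
          (hM.injOn_fst.mono inter_subset_left)
      refine (this.image Prod.snd).subset ?_
      rintro _ ⟨⟨p, hp, rfl⟩, hpx⟩
      exact ⟨p, ⟨hp, ⟨(hMA hp).1, disjoint_left.1 hd ⟨p, hp, rfl⟩⟩,
        E.trans (hM.subset hp) hpx⟩, rfl⟩
    refine (hfin.union hRfin).subset fun y hy => ?_
    by_cases hyR : y ∈ R
    · exact .inr ⟨hyR, hy.2⟩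
    · exact .inl ⟨⟨hy.1, hyR⟩, hy.2⟩
  · have hDR : μ D = μ R := hM.measure_image_fst_eq_image_snd hμ
    have hWR : μ (A \ (D ∪ R)) ≤ μ R := by
      have h1 : Prod.fst '' H = A \ (D ∪ R) := by
        rw [hHf]
        ext x
        constructor
        · rintro ⟨p, hp, rfl⟩
          exact hp.2.1
        · intro hx
          obtain ⟨y, hy, hxy⟩ := hRx x hx
          exact ⟨(x, y), ⟨hxy, hx, hy⟩, rfl⟩
      rw [← h1, hH.measure_image_fst_eq_image_snd hμ]
      refine measure_mono ?_
      rintro _ ⟨p, hp, rfl⟩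
      exact (hHs hp).2.2
    have hAle : μ A ≤ μ D + μ R + μ (A \ (D ∪ R)) := by
      calc μ A ≤ μ (D ∪ R ∪ A \ (D ∪ R)) :=
          measure_mono (by rw [union_sdiff_self]; exact subset_union_right)
        _ ≤ μ (D ∪ R) + μ (A \ (D ∪ R)) := measure_union_le _ _
        _ ≤ _ := by gcongr; exact measure_union_le _ _
    have h3 (a : ℝ≥0∞) : 3 * a = a + a + a := by ring
    rw [hA', h3, h3]
    constructor
    · refine hAle.trans ?_
      have h1 : D ⊆ A \ R := fun x hx => ⟨hDA hx, disjoint_left.1 hd hx⟩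
      have h2 : A \ (D ∪ R) ⊆ A \ R := sdiff_subset_sdiff_right subset_union_right
      rw [← hDR]
      gcongr
    · rw [hDR] at hAle
      exact hAle.trans (by gcongr)

end BorelEq

end Invariance

/-! ### A density with infinite integral, and cocycle-invariant measures -/

noncomputable section InfiniteIntegral

open MeasureTheory Set
open scoped ENNReal

namespace BorelEq

variable {X : Type*} [MeasurableSpace X]

/-- There is a positive Borel function whose integral is infinite for every nonzero invariant
measure. -/
theorem exists_lintegral_eq_top [StandardBorelSpace X] {E : Setoid X} (hE : IsBorel E)
    (hc : HasCountableClasses E) (ha : IsAperiodic E) :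
    ∃ f : X → PosReal, Measurable f ∧ ∀ μ : Measure X, IsInvariant E μ → μ univ ≠ 0 →
      ∫⁻ x, ENNReal.ofReal (f x : ℝ) ∂μ = ∞ := by
  classical
  let T := {A : Set X // MeasurableSet A ∧ ∀ x, (A ∩ {y | E y x}).Infinite}
  have hsplit (A : T) : ∃ B : T, B.1 ⊆ A.1 ∧ ∀ μ : Measure X, IsInvariant E μ →
      μ A.1 ≤ 3 * μ B.1 ∧ μ A.1 ≤ 3 * μ (A.1 \ B.1) := by
    obtain ⟨B, hBA, hB, hBi, h⟩ := exists_split hE hc A.2.1 A.2.2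
    exact ⟨⟨B, hB, hBi⟩, hBA, h⟩
  choose next hsub hnext using hsplit
  let A : ℕ → T := fun n => Nat.rec ⟨univ, .univ, fun x => by simpa using ha x⟩ (fun _ => next) n
  have hA0 : (A 0).1 = univ := rfl
  have hA n : A (n + 1) = next (A n) := rfl
  have hanti : Antitone fun n => (A n).1 := antitone_nat_of_succ_le fun n => hsub (A n)
  -- The second alternative covers the points in every `A m`, which get the value `N x = 0`; the
  -- estimate does not involve them.
  have hex x : ∃ n, x ∉ (A (n + 1)).1 ∨ ∀ m, x ∈ (A m).1 := by
    by_contra! h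
    obtain ⟨m, hm⟩ := (h 0).2
    exact hm (hanti (Nat.le_succ m) (h m).1)
  let N : X → ℕ := fun x => Nat.find (hex x)
  have hN : Measurable N := measurable_find hex fun n => by
    have : MeasurableSet {x | ∀ m, x ∈ (A m).1} := by
      rw [ofPred_forall]
      exact .iInter fun m => (A m).2.1
    exact (A (n + 1)).2.1.compl.union this
  have hNA n x (hx : x ∈ (A n).1 \ (A (n + 1)).1) : N x = n := by
    refine (Nat.find_eq_iff _).2 ⟨.inl hx.2, fun m hm h => ?_⟩
    rcases h with h | h
    · exact h (hanti hm hx.1)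
    · exact hx.2 (h (n + 1))
  have hNm : Measurable fun x => (3 : ℝ) ^ (N x + 1) :=
    (measurable_from_nat (f := fun n : ℕ => (3 : ℝ) ^ (n + 1))).comp hN
  have hN0 x : (0 : ℝ) < 3 ^ (N x + 1) := by positivity
  refine ⟨fun x => ⟨3 ^ (N x + 1), hN0 x⟩, hNm.subtype_mk (h := hN0), fun μ hμ h0 => ?_⟩
  have hμA n : μ univ ≤ 3 ^ n * μ (A n).1 := by
    induction n with
    | zero => simp [hA0]
    | succ n ih =>
      refine ih.trans ?_
      rw [pow_succ, mul_assoc]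
      gcongr
      exact (hnext (A n) μ hμ).1
  have hB n : μ univ ≤ ∫⁻ x in (A n).1 \ (A (n + 1)).1, ENNReal.ofReal (3 ^ (N x + 1)) ∂μ := by
    rw [setLIntegral_congr_fun (g := fun _ => 3 ^ (n + 1)) ((A n).2.1.diff (A (n + 1)).2.1)
      (fun x hx => by
        simp only [hNA n x hx]
        rw [ENNReal.ofReal_pow (by norm_num)]
        simp), setLIntegral_const, pow_succ, mul_assoc]
    refine (hμA n).trans ?_
    gcongr
    exact (hnext (A n) μ hμ).2
  have hdisj : Pairwise (Function.onFun Disjoint fun n => (A n).1 \ (A (n + 1)).1) := by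
    intro m n hmn
    exact disjoint_left.2 fun x hm hn => hmn ((hNA m x hm).symm.trans (hNA n x hn))
  rw [eq_top_iff]
  calc ∞ = ∑' _ : ℕ, μ univ := (ENNReal.tsum_const_eq_top_of_ne_zero h0).symm
    _ ≤ ∑' n, ∫⁻ x in (A n).1 \ (A (n + 1)).1, ENNReal.ofReal (3 ^ (N x + 1)) ∂μ :=
      ENNReal.tsum_le_tsum hB
    _ = ∫⁻ x in ⋃ n, (A n).1 \ (A (n + 1)).1, ENNReal.ofReal (3 ^ (N x + 1)) ∂μ :=
      (lintegral_iUnion (fun n => (A n).2.1.diff (A (n + 1)).2.1) hdisj _).symm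
    _ ≤ _ := setLIntegral_le_lintegral _ _

/-- If `ρ(x, y) = f(x) / f(y)` and `ν` is `ρ`-invariant, then `ν / f` is `E`-invariant. -/
theorem IsCocycleInvariant.isInvariant_withDensity {E : Setoid X} {ρ : graph E → PosReal}
    {f : X → PosReal} (hf : Measurable f)
    (hρ : ∀ (x y : X) (h : E x y), (ρ ⟨(x, y), h⟩ : ℝ) = (f x : ℝ) / (f y : ℝ)) {ν : Measure X}
    (hν : IsCocycleInvariant ρ ν) :
    IsInvariant E (ν.withDensity fun x => (ENNReal.ofReal (f x : ℝ))⁻¹) := by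
  have hfm : Measurable fun x => ENNReal.ofReal (f x : ℝ) := hf.subtype_val.ennreal_ofReal
  have hfi : Measurable fun x => (ENNReal.ofReal (f x : ℝ))⁻¹ := hfm.inv
  intro T hT B hB
  have hTB : MeasurableSet (T '' B) := T.measurableSet_image.2 hB
  have hmap : ν.map T.symm = ν.withDensity fun x => ENNReal.ofReal ((f (T x) : ℝ) / (f x : ℝ)) := by
    ext s hs
    rw [Measure.map_apply T.symm.measurable hs, ← T.image_eq_preimage_symm, hν T hT s hs,
      withDensity_apply _ hs]
    simp_rw [hρ]
  have hmap' : (ν.map T.symm).map T = ν := by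
    rw [Measure.map_map T.measurable T.symm.measurable]
    simp
  have hdm : Measurable fun x => ENNReal.ofReal ((f (T x) : ℝ) / (f x : ℝ)) :=
    ((hf.subtype_val.comp T.measurable).div hf.subtype_val).ennreal_ofReal
  have hfT : Measurable fun x => (ENNReal.ofReal (f (T x) : ℝ))⁻¹ := hfi.comp T.measurable
  rw [withDensity_apply _ hTB, withDensity_apply _ hB]
  -- Integrate over `T '' B` by pulling back along `T`: the density `f (T x) / f x` of `ν.map
  -- T.symm` times `1 / f (T x)` is `1 / f x`.
  nth_rewrite 1 [← hmap']
  rw [setLIntegral_map hTB hfi T.measurable, T.injective.preimage_image, hmap,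
    setLIntegral_withDensity_eq_setLIntegral_mul _ hdm hfT hB]
  refine lintegral_congr fun x => ?_
  have h1 := (f (T x)).2
  have h2 := (f x).2
  simp only [Pi.mul_apply]
  rw [ENNReal.ofReal_div_of_pos h2, div_eq_mul_inv, mul_right_comm,
    ENNReal.mul_inv_cancel (ENNReal.ofReal_pos.2 h1).ne' ENNReal.ofReal_ne_top, one_mul]

/-- The integral of `f` against the invariant measure `ν / f` is `ν univ = 1`, which is finite and
also forces `ν / f` to be nonzero. -/
theorem not_isCocycleInvariant {E : Setoid X} {ρ : graph E → PosReal}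
    {f : X → PosReal} (hf : Measurable f)
    (hρ : ∀ (x y : X) (h : E x y), (ρ ⟨(x, y), h⟩ : ℝ) = (f x : ℝ) / (f y : ℝ))
    (htop : ∀ μ : Measure X, IsInvariant E μ → μ univ ≠ 0 →
      ∫⁻ x, ENNReal.ofReal (f x : ℝ) ∂μ = ∞) (ν : Measure X) [IsProbabilityMeasure ν] :
    ¬ IsCocycleInvariant ρ ν := by
  intro hν
  have hfm : Measurable fun x => ENNReal.ofReal (f x : ℝ) := hf.subtype_val.ennreal_ofReal
  have hfi : Measurable fun x => (ENNReal.ofReal (f x : ℝ))⁻¹ := hfm.inv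
  have h1 : ∫⁻ x, ENNReal.ofReal (f x : ℝ)
      ∂(ν.withDensity fun x => (ENNReal.ofReal (f x : ℝ))⁻¹) = 1 := by
    rw [lintegral_withDensity_eq_lintegral_mul _ hfi hfm]
    have (x : X) :
        ((fun x => (ENNReal.ofReal (f x : ℝ))⁻¹) * fun x => ENNReal.ofReal (f x : ℝ)) x = 1 :=
      ENNReal.inv_mul_cancel (ENNReal.ofReal_pos.2 (f x).2).ne' ENNReal.ofReal_ne_top
    simp_rw [this]
    simp
  rw [htop _ (hν.isInvariant_withDensity hf hρ)] at h1
  · exact ENNReal.top_ne_one h1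
  · intro h0
    rw [Measure.measure_univ_eq_zero.1 h0] at h1
    simp at h1

end BorelEq

end InfiniteIntegral

/-! ### Compressions of quotients of coboundaries -/

noncomputable section Compressions

open MeasureTheory Set
open scoped ENNReal

namespace BorelEq

/-- By Lusin–Novikov the sum splits into countably many sums over sections with at most one point.
This makes the weight of an `F`-class a Borel function of its points. -/
theorem measurable_tsum_section {X Y : Type*} [MeasurableSpace X] [MeasurableSpace Y]
    [StandardBorelSpace X] [StandardBorelSpace Y] {P : Set (X × Y)}
    (hP : MeasurableSet P) (hc : ∀ x, {y | (x, y) ∈ P}.Countable) {f : Y → ℝ≥0∞}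
    (hf : Measurable f) : Measurable fun x => ∑' y : {y | (x, y) ∈ P}, f y := by
  obtain ⟨G, hG, hGi, rfl⟩ := isSigmaGraph_of_countable hP hc
  have hLm n : MeasurableSet (disjointed G n) := .disjointed hG n
  have hLi n : InjOn Prod.fst (disjointed G n) := (hGi n).mono (disjointed_subset G n)
  have h (x : X) : ∑' y : {y | (x, y) ∈ ⋃ n, G n}, f y =
      ∑' n, ∑' y : {y | (x, y) ∈ disjointed G n}, f y := by
    rw [← ENNReal.tsum_biUnion]
    · have : {y | (x, y) ∈ ⋃ n, G n} = ⋃ n, {y | (x, y) ∈ disjointed G n} := by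
        rw [← iUnion_disjointed]
        ext y
        simp
      rw [this]
    · exact fun m _ n _ hmn => disjoint_left.2 fun y hm hn =>
        disjoint_left.1 (disjoint_disjointed G hmn) hm hn
  simp_rw [h]
  refine Measurable.tsum fun n => measurable_of_Ioi fun t => ?_
  have : (fun x => ∑' y : {y | (x, y) ∈ disjointed G n}, f y) ⁻¹' Ioi t =
      Prod.fst '' (disjointed G n ∩ Prod.snd ⁻¹' (f ⁻¹' Ioi t)) := by
    ext x
    by_cases hx : ∃ y, (x, y) ∈ disjointed G n
    · obtain ⟨y, hy⟩ := hx
      have huniq : {y | (x, y) ∈ disjointed G n} = {y} :=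
        eq_singleton_iff_unique_mem.2 ⟨hy, fun z hz => congr_arg Prod.snd (hLi n hz hy rfl)⟩
      rw [mem_preimage, huniq, tsum_singleton]
      refine ⟨fun h => ⟨(x, y), ⟨hy, h⟩, rfl⟩, ?_⟩
      rintro ⟨⟨x, z⟩, ⟨h1, h2⟩, rfl⟩
      obtain rfl : z = y := congr_arg Prod.snd (hLi n h1 hy rfl)
      exact h2
    · have hempty : {y | (x, y) ∈ disjointed G n} = ∅ :=
        eq_empty_of_forall_notMem fun y hy => hx ⟨y, hy⟩
      rw [mem_preimage, hempty, tsum_empty]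
      refine iff_of_false (by simp) ?_
      rintro ⟨⟨x, z⟩, ⟨h1, -⟩, rfl⟩
      exact hx ⟨z, h1⟩
  rw [this]
  exact ((hLm n).inter (measurable_snd (hf measurableSet_Ioi))).image_of_measurable_injOn
    measurable_fst ((hLi n).mono inter_subset_left)

/-- A finite Borel equivalence relation has a Borel selector, that is, a Borel reduction to
equality that picks a point of each class. -/
theorem exists_selector {X : Type*} [MeasurableSpace X] [StandardBorelSpace X] {F : Setoid X}
    (hF : IsBorel F) (hfin : HasFiniteClasses F) :
    ∃ s : X → X, Measurable s ∧ (∀ x, F x (s x)) ∧ ∀ x y, F x y → s x = s y := by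
  let e : X → ℝ := embeddingReal X
  have he : MeasurableEmbedding e := measurableEmbedding_embeddingReal X
  let P : Set (X × X) := {p | F p.2 p.1 ∧ e p.2 < e p.1}
  have hP : MeasurableSet P := MeasurableSet.inter (measurable_swap hF) <|
    measurableSet_lt (he.measurable.comp measurable_snd) (he.measurable.comp measurable_fst)
  -- The points that are least in their class for the order pulled back from `ℝ`.
  have hS : MeasurableSet (Prod.fst '' P)ᶜ :=
    (measurableSet_image_fst hP fun x => ((hfin x).subset fun y hy => hy.1).countable).compl
  have hmin {x y : X} (hx : x ∈ (Prod.fst '' P)ᶜ) (h : F x y) : e x ≤ e y := by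
    by_contra! hlt
    exact hx ⟨(x, y), ⟨F.symm h, hlt⟩, rfl⟩
  have hex x : ∃ y, F x y ∧ y ∈ (Prod.fst '' P)ᶜ := by
    obtain ⟨y, hy, hmin⟩ := exists_min_image _ e (hfin x) ⟨x, F.refl x⟩
    refine ⟨y, F.symm hy, ?_⟩
    rintro ⟨⟨y, z⟩, ⟨h1, h2⟩, rfl⟩
    exact h2.not_ge (hmin z (F.trans h1 hy))
  have hun {y z} (hy : y ∈ (Prod.fst '' P)ᶜ) (hz : z ∈ (Prod.fst '' P)ᶜ) (h : F y z) : y = z :=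
    he.injective ((hmin hy h).antisymm (hmin hz (F.symm h)))
  choose s hs hsS using hex
  refine ⟨s, ?_, hs, fun x y h => hun (hsS x) (hsS y)
    (F.trans (F.symm (hs x)) (F.trans h (hs y)))⟩
  refine measurable_of_measurableSet_graph ?_
  convert! MeasurableSet.inter hF (measurable_snd hS)
  ext ⟨x, y⟩
  constructor
  · rintro (rfl : s x = y)
    exact ⟨hs x, hsS x⟩
  · rintro ⟨h1, h2⟩
    exact hun (hsS x) h2 (F.trans (F.symm (hs x)) h1)

/-- The total weight of a set. -/
def weight {X : Type*} (f : X → PosReal) (Y : Set X) : ℝ≥0∞ :=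
  ∑' y : Y, ENNReal.ofReal (f y : ℝ)

section Coboundary

variable {X : Type*} {E F : Setoid X} {ρ : graph E → PosReal} {f : X → PosReal}

theorem size_eq_weight_div
    (hρ : ∀ (x y : X) (h : E x y), (ρ ⟨(x, y), h⟩ : ℝ) = (f x : ℝ) / (f y : ℝ)) {Y : Set X} {z : X}
    (hY : ∀ y ∈ Y, E y z) : size ρ Y z = weight f Y / ENNReal.ofReal (f z : ℝ) := by
  unfold size weight
  simp_rw [hρ, ENNReal.ofReal_div_of_pos (f z).2, div_eq_mul_inv, ENNReal.tsum_mul_right]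
  congr 1
  let e : {y : X // y ∈ Y ∧ E y z} ≃ Y :=
    Equiv.subtypeEquivRight fun y => ⟨fun h => h.1, fun h => ⟨h, hY y h⟩⟩
  exact e.tsum_eq fun y : Y => ENNReal.ofReal (f y : ℝ)

theorem weight_ne_zero {Y : Set X} (hY : Y.Nonempty) : weight f Y ≠ 0 := by
  obtain ⟨y, hy⟩ := hY
  intro h
  exact (ENNReal.ofReal_pos.2 (f y).2).ne' (ENNReal.tsum_eq_zero.1 h ⟨y, hy⟩)

theorem weight_ne_top {Y : Set X} (hY : Y.Finite) : weight f Y ≠ ∞ := by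
  have := hY.fintype
  unfold weight
  rw [tsum_fintype]
  exact (ENNReal.sum_lt_top.2 fun _ _ => ENNReal.ofReal_lt_top).ne

theorem classOf_nonempty (C : Quotient F) : (classOf C).Nonempty := ⟨C.out, Quotient.out_eq C⟩

theorem ofReal_quotientCocycle
    (hρ : ∀ (x y : X) (h : E x y), (ρ ⟨(x, y), h⟩ : ℝ) = (f x : ℝ) / (f y : ℝ)) (hFE : F ≤ E)
    (hF : HasFiniteClasses F) (C D : Quotient F) (h : quotientRel E F hFE C D) :
    ENNReal.ofReal (quotientCocycle hFE hF ρ ⟨(C, D), h⟩ : ℝ) =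
      weight f (classOf C) / weight f (classOf D) := by
  have hD : D.out ∈ classOf D := Quotient.out_eq D
  have h1 := weight_ne_zero (f := f) (classOf_nonempty D)
  have h2 := weight_ne_top (f := f) (classOf_finite hF C)
  have h3 : relSize ρ (classOf C) (classOf D) D.out =
      weight f (classOf C) / weight f (classOf D) := by
    rw [relSize, size_eq_weight_div hρ fun y hy => rel_out hFE h hy hD,
      size_eq_weight_div hρ fun y hy => rel_out hFE ((quotientRel E F hFE).refl D) hy hD,
      div_eq_mul_inv (weight f (classOf C)), div_eq_mul_inv (weight f (classOf D)),
      ENNReal.mul_div_mul_right _ _ (ENNReal.inv_ne_zero.2 ENNReal.ofReal_ne_top)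
        (ENNReal.inv_ne_top.2 (ENNReal.ofReal_pos.2 (f D.out).2).ne')]
  change ENNReal.ofReal (relSize ρ (classOf C) (classOf D) D.out).toReal = _
  rw [h3, ENNReal.ofReal_toReal (ENNReal.div_ne_top h2 h1)]

/-- The left side is the single term of `C` in the sum over the fibre of `φ` through `C`. -/
theorem IsCompression.weight_div_le_size
    (hρ : ∀ (x y : X) (h : E x y), (ρ ⟨(x, y), h⟩ : ℝ) = (f x : ℝ) / (f y : ℝ)) {hFE : F ≤ E}
    {hF : HasFiniteClasses F} {φ : Quotient F → Quotient F}
    (hφ : IsCompression (quotientCocycle hFE hF ρ) φ) (C : Quotient F) :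
    weight f (classOf C) / weight f (classOf (φ C)) ≤
      size (quotientCocycle hFE hF ρ) (φ ⁻¹' {φ C}) (φ C) := by
  rw [← ofReal_quotientCocycle hρ hFE hF C (φ C) (hφ.1 C)]
  exact ENNReal.le_tsum (f := fun D : {D // D ∈ φ ⁻¹' {φ C} ∧ quotientRel E F hFE D (φ C)} =>
    ENNReal.ofReal (quotientCocycle hFE hF ρ ⟨((D : Quotient F), φ C), D.2.2⟩ : ℝ))
    ⟨C, rfl, hφ.1 C⟩

theorem IsCompression.weight_le
    (hρ : ∀ (x y : X) (h : E x y), (ρ ⟨(x, y), h⟩ : ℝ) = (f x : ℝ) / (f y : ℝ)) {hFE : F ≤ E}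
    {hF : HasFiniteClasses F} {φ : Quotient F → Quotient F}
    (hφ : IsCompression (quotientCocycle hFE hF ρ) φ) (C : Quotient F) :
    weight f (classOf C) ≤ weight f (classOf (φ C)) := by
  have := (hφ.weight_div_le_size hρ C).trans (hφ.2.1 _)
  rwa [ENNReal.div_le_iff (weight_ne_zero (classOf_nonempty _))
    (weight_ne_top (classOf_finite hF _)), one_mul] at this

theorem IsCompression.weight_lt
    (hρ : ∀ (x y : X) (h : E x y), (ρ ⟨(x, y), h⟩ : ℝ) = (f x : ℝ) / (f y : ℝ)) {hFE : F ≤ E}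
    {hF : HasFiniteClasses F} {φ : Quotient F → Quotient F}
    (hφ : IsCompression (quotientCocycle hFE hF ρ) φ) (C : Quotient F)
    (h : size (quotientCocycle hFE hF ρ) (φ ⁻¹' {φ C}) (φ C) < 1) :
    weight f (classOf C) < weight f (classOf (φ C)) := by
  have := (hφ.weight_div_le_size hρ C).trans_lt h
  rwa [ENNReal.div_lt_iff (.inl (weight_ne_zero (classOf_nonempty _)))
    (.inl (weight_ne_top (classOf_finite hF _))), one_mul] at this

end Coboundary

/-- An injection which preserves a finite measure on `S` and does not decrease `g` leaves `g`
unchanged almost everywhere. -/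
theorem measure_lt_comp_eq_zero {X : Type*} [MeasurableSpace X] {μ : Measure X}
    [IsFiniteMeasure μ] {S : Set X} (hS : MeasurableSet S) {g : X → ℝ≥0∞} (hg : Measurable g)
    {h : X → X} (hh : Measurable h) (hhS : MapsTo h S S)
    (hμ : ∀ B ⊆ S, MeasurableSet B → μ (h '' B) = μ B) (hle : ∀ x ∈ S, g x ≤ g (h x)) :
    μ {x | x ∈ S ∧ g x < g (h x)} = 0 := by
  let t : ℚ → ℝ≥0∞ := fun q => (Real.toNNReal q : ℝ≥0∞)
  have hsub : {x | x ∈ S ∧ g x < g (h x)} ⊆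
      ⋃ q, {x | x ∈ S ∧ t q < g (h x)} \ {x | x ∈ S ∧ t q < g x} := by
    rintro x ⟨hx, hlt⟩
    obtain ⟨q, -, h1, h2⟩ := ENNReal.lt_iff_exists_rat_btwn.1 hlt
    exact mem_iUnion.2 ⟨q, ⟨hx, h2⟩, fun h3 => h3.2.not_gt h1⟩
  refine measure_mono_null hsub (measure_iUnion_null fun q => ?_)
  have h1 : MeasurableSet {x | x ∈ S ∧ t q < g (h x)} :=
    hS.inter (measurableSet_lt measurable_const (hg.comp hh))
  have h2 : MeasurableSet {x | x ∈ S ∧ t q < g x} :=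
    hS.inter (measurableSet_lt measurable_const hg)
  have h3 : {x | x ∈ S ∧ t q < g x} ⊆ {x | x ∈ S ∧ t q < g (h x)} :=
    fun x hx => ⟨hx.1, hx.2.trans_le (hle x hx.1)⟩
  rw [measure_sdiff h3 h2.nullMeasurableSet
    -- `h` maps the larger set `{t q < g ∘ h}` into the smaller `{t q < g}`, so finiteness of the
    -- measure makes their difference null.
    (measure_ne_top _ _), ← hμ _ (fun x hx => hx.1) h1]
  refine tsub_eq_zero_of_le (measure_mono ?_)
  rintro _ ⟨x, hx, rfl⟩
  exact ⟨hhS hx.1, hx.2⟩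

/-- If there is an `E`-invariant Borel probability measure, then no quotient of a Borel coboundary
by a finite Borel subequivalence relation of `E` has an injective Borel compression. -/
theorem not_hasInjectiveBorelQuotientCompression {X : Type*} [MeasurableSpace X]
    [StandardBorelSpace X] {E : Setoid X} (hE : IsBorel E) (hc : HasCountableClasses E)
    {μ : Measure X} [IsProbabilityMeasure μ] (hμ : IsInvariant E μ) {ρ : graph E → PosReal}
    {f : X → PosReal} (hf : Measurable f)
    (hρ : ∀ (x y : X) (h : E x y), (ρ ⟨(x, y), h⟩ : ℝ) = (f x : ℝ) / (f y : ℝ)) :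
    ¬ HasInjectiveBorelQuotientCompression ρ := by
  rintro ⟨F, hFE, hfin, hF, φ, hφm, hφi, hφ⟩
  obtain ⟨s, hsm, hFs, hs⟩ := exists_selector hF hfin
  let σ : Quotient F → X := Quotient.lift s hs
  have hσm : Measurable σ := measurable_from_quotient.2 hsm
  have hσ (C : Quotient F) : Quotient.mk F (σ C) = C := by
    induction C using Quotient.inductionOn with
    | h x => exact Quotient.sound (F.symm (hFs x))
  let S : Set X := {x | s x = x}
  have hS : MeasurableSet S := measurableSet_eq_fun hsm measurable_id
  have hσS (C : Quotient F) : σ C ∈ S := by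
    induction C using Quotient.inductionOn with
    | h x => exact (hs x (s x) (hFs x)).symm
  have hSσ {x} (hx : x ∈ S) : σ (Quotient.mk F x) = x := hx
  let h : X → X := fun x => σ (φ (Quotient.mk F x))
  have hhm : Measurable h := hσm.comp (hφm.comp measurable_quotient_mk'')
  have hmk x : Quotient.mk F (h x) = φ (Quotient.mk F x) := hσ _
  have hhS : MapsTo h S S := fun x _ => hσS _
  have hEh x : E x (h x) := rel_out hFE (hφ.1 (Quotient.mk F x)) rfl (hmk x)
  have hinj : InjOn h S := by
    intro x hx y hy hxy
    have := congr_arg (Quotient.mk F) hxy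
    rw [hmk, hmk] at this
    rw [← hSσ hx, hφi this, hSσ hy]
  have hpres (B : Set X) (hBS : B ⊆ S) (hB : MeasurableSet B) : μ (h '' B) = μ B := by
    have hM : IsPartialInjection E ((fun x => (x, h x)) '' B) := by
      refine ⟨hB.image_of_measurable_injOn (measurable_id.prodMk hhm)
        fun x _ y _ hxy => congr_arg Prod.fst hxy, ?_, ?_, ?_⟩
      · rintro _ ⟨x, -, rfl⟩
        exact hEh x
      · rintro _ ⟨x, -, rfl⟩ _ ⟨y, -, rfl⟩ (rfl : x = y)
        rfl
      · rintro _ ⟨x, hx, rfl⟩ _ ⟨y, hy, rfl⟩ (hxy : h x = h y)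
        rw [hinj (hBS hx) (hBS hy) hxy]
    simpa [image_image] using (hM.measure_image_fst_eq_image_snd hμ).symm
  let g : X → ℝ≥0∞ := fun x => weight f (classOf (Quotient.mk F x))
  have hg : Measurable g := by
    have := measurable_tsum_section (P := Prod.swap ⁻¹' graph F) (measurable_swap hF)
      (fun x => (hfin x).countable) hf.subtype_val.ennreal_ofReal
    convert! this using 2 with x
    have : classOf (Quotient.mk F x) = {y | (x, y) ∈ Prod.swap ⁻¹' graph F} := by
      ext y
      exact Quotient.eq
    simp only [g, weight]
    rw [this]
  have hle x : g x ≤ g (h x) := by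
    simp only [g, hmk]
    exact hφ.weight_le hρ _
  have hKm : MeasurableSet {x | x ∈ S ∧ g x < g (h x)} :=
    hS.inter (measurableSet_lt hg (hg.comp hhm))
  have hK := measure_lt_comp_eq_zero (μ := μ) hS hg hhm hhS hpres fun x _ => hle x
  set K := {x | x ∈ S ∧ g x < g (h x)}
  have hKS : K ⊆ S := fun x hx => hx.1
  have himg {B : Set X} (hBS : B ⊆ S) (hB : MeasurableSet B) : MeasurableSet (h '' B) :=
    hB.image_of_measurable_injOn hhm (hinj.mono hBS)
  -- A representative whose class has fibre of size below 1 is either missed by `h` or the image of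
  -- a point where the weight strictly increases.
  have hN : μ (S \ h '' S ∪ h '' K) = 0 := by
    refine measure_union_null ?_ ((hpres K hKS hKm).trans hK)
    rw [measure_sdiff hhS.image_subset (himg subset_rfl hS).nullMeasurableSet (measure_ne_top _ _),
      hpres S subset_rfl hS, tsub_self]
  have hsat := measure_saturation_eq_zero hE hc hμ
    ((hS.diff (himg subset_rfl hS)).union (himg hKS hKm)) hN
  have huniv : {x | ∃ y ∈ S \ h '' S ∪ h '' K, E x y} = univ := by
    refine eq_univ_of_forall fun x => ?_
    obtain ⟨D, hD, hlt⟩ := hφ.2.2 (Quotient.mk F x)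
    refine ⟨σ D, ?_, rel_out hFE hD rfl (hσ D)⟩
    by_cases hDh : σ D ∈ h '' S
    · obtain ⟨y, hy, hyD⟩ := hDh
      refine .inr ⟨y, ⟨hy, ?_⟩, hyD⟩
      obtain rfl : φ (Quotient.mk F y) = D := by rw [← hmk, hyD, hσ]
      simp only [g, hmk]
      exact hφ.weight_lt hρ _ hlt
    · exact .inl ⟨hσS D, hDh⟩
  rw [huniv] at hsat
  simp at hsat

end BorelEq

end Compressions

theorem mainTheorem7 {X : Type*} [MeasurableSpace X] [StandardBorelSpace X] (E : Setoid X)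
    (hE : BorelEq.IsBorel E) (hcount : BorelEq.HasCountableClasses E)
    (haper : BorelEq.IsAperiodic E)
    (hinv : ∃ μ : MeasureTheory.Measure X,
      MeasureTheory.IsProbabilityMeasure μ ∧ BorelEq.IsInvariant E μ) :
    ∃ ρ : BorelEq.graph E → BorelEq.PosReal,
      BorelEq.IsBorelCoboundary ρ ∧
      ¬ BorelEq.HasInjectiveBorelQuotientCompression ρ ∧
      ¬ ∃ μ : MeasureTheory.Measure X,
        MeasureTheory.IsProbabilityMeasure μ ∧ BorelEq.IsCocycleInvariant ρ μ := by
  obtain ⟨μ, _, hμ⟩ := hinv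
  obtain ⟨f, hf, htop⟩ := BorelEq.exists_lintegral_eq_top hE hcount haper
  let ρ : BorelEq.graph E → BorelEq.PosReal := fun p =>
    ⟨(f p.1.1 : ℝ) / (f p.1.2 : ℝ), div_pos (f p.1.1).2 (f p.1.2).2⟩
  have hρ (x y : X) (h : E x y) : (ρ ⟨(x, y), h⟩ : ℝ) = (f x : ℝ) / (f y : ℝ) := rfl
  have hρm : Measurable fun p : BorelEq.graph E => (f p.1.1 : ℝ) / (f p.1.2 : ℝ) :=
    (hf.comp measurable_subtype_coe.fst).subtype_val.div
      (hf.comp measurable_subtype_coe.snd).subtype_val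
  refine ⟨ρ, ⟨⟨hρm.subtype_mk (h := fun p => div_pos (f p.1.1).2 (f p.1.2).2),
      fun x y z hxy hyz => ?_⟩, f, hf, hρ⟩,
    BorelEq.not_hasInjectiveBorelQuotientCompression hE hcount hμ hf hρ, ?_⟩
  · rw [hρ, hρ, hρ, div_mul_div_cancel₀ (f y).2.ne']
  · rintro ⟨ν, _, hν⟩
    exact BorelEq.not_isCocycleInvariant hf hρ htop ν hν
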